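/- Let $G$ be a finite graph and $A\subseteq V(G)$. An $A$-path is a path of length at least $1$ whose first and last vertex lie in $A$ and none of whose interior vertices lies in $A$; its length is its number of edges. For a class of $A$-paths, the Erdős–Pósa property means: there is a function $f:\mathbb N\to\mathbb N$ such that for every $k$, every finite graph $G$ and every $A\subseteq V(G)$, either $G$ contains $k$ pairwise vertex-disjoint $A$-paths of the class, or there is a set $X\subseteq V(G)$ with $|X|\le f(k)$ that meets every $A$-path of the class in $G$. **Proposition 4.2.** For every composite integer $m>4$ and every $d\in\{0,\ldots,m-1\}$, the $A$-paths of length congruent to $d$ modulo $m$ do not have the Erdős–Pósa property. The property fails already for $k=2$: for every $N$ there are a finite graph $G$ and a set $A\subseteq V(G)$ such that $G$ contains no two disjoint $A$-paths of length congruent to $d$ modulo $m$, while every vertex set that meets all $A$-paths of length congruent to $d$ modulo $m$ has more than $N$ vertices. -/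

import Mathlib

/-- An `A`-path in the graph `G`: a path of length at least one (equivalently, with two distinct
endvertices) whose first and last vertex lie in `A` and none of whose interior vertices lies
in `A`. -/
structure APath {V : Type} (G : SimpleGraph V) (A : Set V) where
  first : V
  last : V
  walk : G.Walk first last
  isPath : walk.IsPath
  ne : first ≠ last
  first_mem : first ∈ A
  last_mem : last ∈ A
  interior : ∀ w ∈ walk.support, w ∈ A → w = first ∨ w = last

/-- The length (number of edges) of an `A`-path. -/
def APath.length {V : Type} {G : SimpleGraph V} {A : Set V} (P : APath G A) : ℕ :=
  P.walk.length

/-- The vertex set of an `A`-path. -/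
def APath.verts {V : Type} {G : SimpleGraph V} {A : Set V} (P : APath G A) : Set V :=
  {w | w ∈ P.walk.support}

/-- `G` contains `k` pairwise vertex-disjoint `A`-paths whose lengths satisfy `L`. -/
def HasDisjointAPaths {V : Type} (G : SimpleGraph V) (A : Set V) (L : ℕ → Prop) (k : ℕ) : Prop :=
  ∃ P : Fin k → APath G A,
    (∀ i, L (P i).length) ∧ ∀ i j, i ≠ j → Disjoint (P i).verts (P j).verts

/-- `X` is a hitting set: it meets every `A`-path of `G` whose length satisfies `L`. -/
def IsHittingSet {V : Type} (G : SimpleGraph V) (A : Set V) (L : ℕ → Prop) (X : Finset V) : Prop :=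
  ∀ P : APath G A, L P.length → ∃ w ∈ X, w ∈ P.verts

/-- The Erdős–Pósa property of the `A`-paths whose length satisfies `L`: there is a function `f`
such that for every `k`, every finite graph `G` and every vertex set `A`, the graph contains `k`
disjoint such `A`-paths or a set of at most `f k` vertices that meets all of them. -/
def APathsHaveErdosPosaProperty (L : ℕ → Prop) : Prop :=
  ∃ f : ℕ → ℕ, ∀ (k : ℕ) (V : Type) [Finite V] (G : SimpleGraph V) (A : Set V),
    HasDisjointAPaths G A L k ∨ ∃ X : Finset V, X.card ≤ f k ∧ IsHittingSet G A L X

/-! Let `q` be a proper divisor of `m` with `q ≥ 3`. With first coordinates pointing down and second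
ones right, curve `i` follows row `i * m` to the right, bends through `k = q` diagonal steps and
descends in column `a + (i + 1) * m`. `A` consists of the left and bottom sides. Lengths: all
crossings are `(0, a)` modulo `m`, so `dartPhase` grows by one per step even where a path changes
curves. The bends break this modulo `m`, but not modulo `q`. Hence left-left and bottom-bottom paths
have lengths `2a` and `2b` modulo `q`, and a left-bottom path avoiding the diagonals has length `a +
b` modulo `m`. Choose `2a ≢ d` modulo `q` and `a + b = d + q`; then `2b ≢ d` modulo `q` as well, so
every path of length `d` modulo `m` joins left to bottom and touches a diagonal. Each whole curve
has such a length, `a + b - q`. Topology: the drawing is planar apart from the crossings, which are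
vertices, and its diagonals lie on the outer boundary. Of two such paths, the one starting higher
separates the start of the other from all diagonals, so they meet
(`exists_mem_support_of_left_walks`). A vertex lies on at most two curves, so hitting sets grow with
the number of curves. -/

/-- If consecutive non-backtracking darts inside `S` increase `φ` by one, then the value of `φ` on
the last dart of a path is determined by that on the first dart and the length. -/
theorem SimpleGraph.Walk.IsPath.exists_last_dart {V R : Type*} [AddCommGroupWithOne R]
    {G : SimpleGraph V} (φ : V → V → R) (S : Set V)
    (hφ : ∀ u v w, G.Adj u v → G.Adj v w → u ≠ w → u ∈ S → v ∈ S → w ∈ S →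
      φ v w = φ u v + 1) :
    ∀ {v w : V} (p : G.Walk v w) {u : V} (h : G.Adj u v),
      (SimpleGraph.Walk.cons h p).IsPath → (∀ z ∈ (SimpleGraph.Walk.cons h p).support, z ∈ S) →
      ∃ z ∈ S, G.Adj z w ∧ φ z w = φ u v + (p.length : R) := by
  intro v w p
  induction p with
  | nil => intro u h _ hS; exact ⟨u, hS u (by simp), h, by simp⟩
  | @cons v v' w h' p ih =>
    intro u h hp hS
    rw [SimpleGraph.Walk.cons_isPath_iff] at hp
    have hu : u ≠ v' := by
      rintro rfl
      exact hp.2 (by simp)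
    obtain ⟨z, hzS, hz, e⟩ := ih h' hp.1 (fun z hz => hS z (by
      rw [SimpleGraph.Walk.support_cons]; exact List.mem_cons_of_mem _ hz))
    refine ⟨z, hzS, hz, ?_⟩
    rw [e, hφ u v v' h h' hu (hS _ (by simp)) (hS _ (by simp)) (hS _ (by simp))]
    simp only [SimpleGraph.Walk.length_cons]
    push_cast
    abel

/-- A sequence of consecutively adjacent vertices is the vertex sequence of a walk. -/
theorem SimpleGraph.exists_walk_of_seq {V : Type*} {G : SimpleGraph V} (γ : ℕ → V) (l : ℕ)
    (h : ∀ t < l, G.Adj (γ t) (γ (t + 1))) :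
    ∃ W : G.Walk (γ 0) (γ l), W.length = l ∧ W.support = (List.range (l + 1)).map γ := by
  induction l with
  | zero => exact ⟨.nil, rfl, rfl⟩
  | succ l ih =>
    obtain ⟨W, hl, hs⟩ := ih (fun t ht => h t (by omega))
    refine ⟨W.concat (h l (by omega)), by simp [hl], ?_⟩
    rw [SimpleGraph.Walk.support_concat, hs, List.range_succ (n := l + 1)]
    simp

/-! ### Crossing parity in the triangular lattice -/

/-- One step in a fixed orientation of the triangular lattice. -/
def TriStep (u v : ℕ × ℕ) : Prop :=
  (v.1 = u.1 ∧ v.2 = u.2 + 1) ∨ (v.1 = u.1 + 1 ∧ (v.2 = u.2 ∨ v.2 = u.2 + 1))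

/-- The edge `uw` leads from the row of `v` to the next one, to the right of `v`. -/
def CrossesRay (v u w : ℕ × ℕ) : Prop :=
  (u.1 = v.1 ∧ w.1 = v.1 + 1 ∧ v.2 < u.2) ∨ (w.1 = v.1 ∧ u.1 = v.1 + 1 ∧ v.2 < w.2)

/-- The parity of the number of edges of a walk that lead from the row of `v` to the next one, to
the right of `v`. -/
def crossingParity {H : SimpleGraph (ℕ × ℕ)} (v : ℕ × ℕ) : ∀ {s e : ℕ × ℕ}, H.Walk s e → Prop
  | _, _, .nil => False
  | _, _, .cons (u := u) (v := w) _ p => ¬ (CrossesRay v u w ↔ crossingParity v p)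

/-- The change of ray is a coboundary: the two crossing indicators of an edge differ by the values
at its ends of the indicator of the points to the right of `v'` in its row. Only a step to a new row
gives a nonzero indicator. -/
theorem crossesRay_triStep {v v' u w : ℕ × ℕ} (h : TriStep v v')
    (h' : TriStep u w ∨ TriStep w u)
    (h1 : u ≠ v) (h2 : u ≠ v') (h3 : w ≠ v) (h4 : w ≠ v') :
    (CrossesRay v u w ↔ CrossesRay v' u w) ↔
      ((v'.1 = v.1 + 1 ∧ u.1 = v'.1 ∧ v'.2 < u.2) ↔
        (v'.1 = v.1 + 1 ∧ w.1 = v'.1 ∧ v'.2 < w.2)) := by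
  obtain ⟨a, b⟩ := v
  obtain ⟨a', b'⟩ := v'
  obtain ⟨c, d⟩ := u
  obtain ⟨c', d'⟩ := w
  simp only [TriStep, CrossesRay, ne_eq, Prod.mk.injEq] at *
  rcases h with ⟨rfl, rfl⟩ | ⟨rfl, rfl | rfl⟩ <;>
    rcases h' with (⟨rfl, rfl⟩ | ⟨rfl, rfl | rfl⟩) | (⟨rfl, rfl⟩ | ⟨rfl, rfl | rfl⟩) <;> omega

/-- The contributions of `crossesRay_triStep` telescope along the walk, leaving only its endpoints.
-/
theorem crossingParity_triStep {H : SimpleGraph (ℕ × ℕ)}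
    (hH : ∀ u v, H.Adj u v → TriStep u v ∨ TriStep v u) {v v' : ℕ × ℕ} (h : TriStep v v')
    {s e : ℕ × ℕ} (p : H.Walk s e) (h1 : v ∉ p.support) (h2 : v' ∉ p.support) :
    (crossingParity v p ↔ crossingParity v' p) ↔
      ((v'.1 = v.1 + 1 ∧ s.1 = v'.1 ∧ v'.2 < s.2) ↔
        (v'.1 = v.1 + 1 ∧ e.1 = v'.1 ∧ v'.2 < e.2)) := by
  induction p with
  | nil => simp [crossingParity]
  | @cons a b c hab p ih =>
    simp only [SimpleGraph.Walk.support_cons, List.mem_cons, not_or] at h1 h2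
    have hb := p.start_mem_support
    have key := crossesRay_triStep h (hH _ _ hab) (Ne.symm h1.1) (Ne.symm h2.1)
      (fun hh => h1.2 (hh ▸ hb)) (fun hh => h2.2 (hh ▸ hb))
    have h := ih h1.2 h2.2
    simp only [crossingParity]
    grind only

/-- Nothing lies to the left of `v`, so every edge between its row and the next one counts. -/
theorem crossingParity_left {H : SimpleGraph (ℕ × ℕ)}
    (hH : ∀ u v, H.Adj u v → TriStep u v ∨ TriStep v u) {v : ℕ × ℕ} (hv : v.2 = 0)
    {s e : ℕ × ℕ} (p : H.Walk s e) (h1 : v ∉ p.support) :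
    ¬ crossingParity v p ↔ (s.1 ≤ v.1 ↔ e.1 ≤ v.1) := by
  induction p with
  | nil => simp [crossingParity]
  | @cons a b c hab p ih =>
    simp only [SimpleGraph.Walk.support_cons, List.mem_cons, not_or] at h1
    have hb := p.start_mem_support
    have hbv : v ≠ b := fun hh => h1.2 (hh ▸ hb)
    have key : ¬ CrossesRay v a b ↔ (a.1 ≤ v.1 ↔ b.1 ≤ v.1) := by
      have h3 := h1.1
      have h4 := hH _ _ hab
      simp only [TriStep, CrossesRay, ne_eq, Prod.ext_iff] at *
      omega
    have := ih h1.2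
    simp only [crossingParity]
    tauto

theorem not_crossingParity {H : SimpleGraph (ℕ × ℕ)} {v : ℕ × ℕ}
    (hv : ∀ u w, H.Adj u w → u.1 = v.1 → w.1 = v.1 + 1 → u.2 ≤ v.2)
    {s e : ℕ × ℕ} (p : H.Walk s e) : ¬ crossingParity v p := by
  induction p with
  | nil => simp [crossingParity]
  | @cons a b c hab p ih =>
    have key : ¬ CrossesRay v a b := by
      rintro (⟨h1, h2, h3⟩ | ⟨h1, h2, h3⟩)
      · have := hv _ _ hab h1 h2
        omega
      · have := hv _ _ hab.symm h1 h2
        omega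
    simp only [crossingParity]
    tauto

/-- In a subgraph of the triangular lattice, a walk `P` from the left side to row `X` and a walk
`Q` that starts on the left side below `P` and leads to a point with no edge on its right meet. -/
theorem exists_mem_support_of_left_walks {H : SimpleGraph (ℕ × ℕ)}
    (hH : ∀ u v, H.Adj u v → TriStep u v ∨ TriStep v u)
    {s e s' e' : ℕ × ℕ} (P : H.Walk s e) (Q : H.Walk s' e')
    (hs : s.2 = 0) (hs' : s'.2 = 0) (hlt : s.1 < s'.1)
    (hQ : ∀ v ∈ Q.support, v.1 < e.1)
    (hv : ∀ u w, H.Adj u w → u.1 = e'.1 → w.1 = e'.1 + 1 → u.2 ≤ e'.2) :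
    ∃ v, v ∈ P.support ∧ v ∈ Q.support := by
  by_contra! hd
  have hstart : crossingParity s' P := by
    have h1 := crossingParity_left hH hs' P (fun h => hd _ h Q.start_mem_support)
    have h2 := hQ _ Q.start_mem_support
    by_contra h3
    have := h1.1 h3
    omega
  have hconst : ∀ {x y : ℕ × ℕ} (R : H.Walk x y), (∀ v ∈ R.support, v ∈ Q.support) →
      (crossingParity x P ↔ crossingParity y P) := by
    have step : ∀ x y, TriStep x y → x ∈ Q.support → y ∈ Q.support →
        (crossingParity x P ↔ crossingParity y P) := by
      intro x y hxy hx hy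
      -- Both endpoint terms vanish: `s` is in column 0 and `e` is in a row below all of `Q`.
      refine (crossingParity_triStep hH hxy P (fun h => hd _ h hx) (fun h => hd _ h hy)).2 ?_
      have := hQ _ hy
      omega
    intro x y R
    induction R with
    | nil => simp
    | @cons x y z hxy R ih =>
      intro hR
      rw [← ih (fun v hv => hR v (by simp [hv]))]
      have hx := hR x (by simp)
      have hy := hR y (by simp)
      rcases hH _ _ hxy with h | h
      · exact step x y h hx hy
      · exact (step y x h hy hx).symm
  exact not_crossingParity hv P ((hconst Q (fun _ h => h)).1 hstart)

/-! ### The curves and their crossings -/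

/-- The coordinates of the points on the first part of the `i`-th curve: from `(i * m, 0)` to the
right, then `k` diagonal steps up to column `a + (i + 1) * m`. -/
def OnRow (m a k i : ℕ) (v : ℕ × ℕ) : Prop :=
  v.1 = i * m + (v.2 + k - (a + (i + 1) * m)) ∧ v.2 ≤ a + (i + 1) * m

/-- The points on the second part of the `i`-th curve, in column `a + (i + 1) * m`. -/
def OnCol (m a k i : ℕ) (v : ℕ × ℕ) : Prop :=
  v.2 = a + (i + 1) * m ∧ i * m + k ≤ v.1

/-- An edge of the first part of one of the first `n` curves, oriented from left to right. -/
def RowStep (n m a k : ℕ) (u v : ℕ × ℕ) : Prop :=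
  ∃ i < n, OnRow m a k i u ∧ OnRow m a k i v ∧ v.2 = u.2 + 1

/-- An edge of the second part of one of the first `n` curves, oriented downwards. -/
def ColStep (n m a k : ℕ) (u v : ℕ × ℕ) : Prop :=
  ∃ i < n, OnCol m a k i u ∧ OnCol m a k i v ∧ v.1 = u.1 + 1

/-- The union of `n` curves, any two of which cross once. -/
def curveGraph (n m a k : ℕ) : SimpleGraph (ℕ × ℕ) where
  Adj u v := (RowStep n m a k u v ∨ RowStep n m a k v u) ∨
    (ColStep n m a k u v ∨ ColStep n m a k v u)
  symm := ⟨by intro u v; tauto⟩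
  loopless := ⟨by
    rintro u ((⟨i, _, _, _, h⟩ | ⟨i, _, _, _, h⟩) | (⟨i, _, _, _, h⟩ | ⟨i, _, _, _, h⟩)) <;> omega⟩

/-- The points on the diagonal segments of the first `n` curves. -/
def OnDiag (n m a k : ℕ) (v : ℕ × ℕ) : Prop :=
  ∃ i < n, OnRow m a k i v ∧ a + (i + 1) * m ≤ v.2 + k

section

variable {n m a k : ℕ}

theorem RowStep.triStep {u v : ℕ × ℕ} (h : RowStep n m a k u v) : TriStep u v := by
  obtain ⟨i, _, ⟨h1, h2⟩, ⟨h3, h4⟩, h5⟩ := h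
  simp only [TriStep]
  omega

theorem ColStep.triStep {u v : ℕ × ℕ} (h : ColStep n m a k u v) : TriStep u v := by
  obtain ⟨i, _, ⟨h1, h2⟩, ⟨h3, h4⟩, h5⟩ := h
  simp only [TriStep]
  omega

theorem curveGraph_triStep (u v : ℕ × ℕ) (h : (curveGraph n m a k).Adj u v) :
    TriStep u v ∨ TriStep v u := by
  rcases h with (h | h) | (h | h)
  · exact .inl h.triStep
  · exact .inr h.triStep
  · exact .inl h.triStep
  · exact .inr h.triStep

theorem OnRow.div_eq (hk : k < m) {i : ℕ} {v : ℕ × ℕ} (h : OnRow m a k i v) : v.1 / m = i := by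
  obtain ⟨h1, h2⟩ := h
  rw [h1, mul_comm, Nat.mul_add_div (by omega), Nat.div_eq_of_lt (by omega), add_zero]

theorem OnRow.unique (hk : k < m) {i j : ℕ} {v : ℕ × ℕ} (h : OnRow m a k i v)
    (h' : OnRow m a k j v) : i = j := (h.div_eq hk).symm.trans (h'.div_eq hk)

theorem OnRow.ext {i : ℕ} {u v : ℕ × ℕ} (h : OnRow m a k i u) (h' : OnRow m a k i v)
    (e : u.2 = v.2) : u = v :=
  Prod.ext (by rw [h.1, h'.1, e]) e

theorem OnCol.div_eq (hk : k < m) {i : ℕ} {v : ℕ × ℕ} (h : OnCol m a k i v) :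
    (v.2 - a) / m - 1 = i := by
  rw [h.1, Nat.add_sub_cancel_left, Nat.mul_div_cancel _ (by omega), Nat.add_sub_cancel]

/-- Where a row and a column meet. -/
theorem OnRow.onCol (hk : k < m) {i j : ℕ} {v : ℕ × ℕ} (h : OnRow m a k i v)
    (h' : OnCol m a k j v) : v.1 = i * m ∨ (i = j ∧ v.1 = i * m + k) := by
  obtain ⟨h1, h2⟩ := h
  obtain ⟨h3, h4⟩ := h'
  rcases lt_trichotomy i j with hij | rfl | hij
  · obtain ⟨c, rfl⟩ := Nat.exists_eq_add_of_lt hij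
    have : a + (i + c + 1 + 1) * m = a + (i + 1) * m + (c * m + m) := by ring
    omega
  · right
    omega
  · left
    obtain ⟨c, rfl⟩ := Nat.exists_eq_add_of_lt hij
    have : a + (j + c + 1 + 1) * m = a + (j + 1) * m + (c * m + m) := by ring
    omega

/-- No edge leads to the next row on the right of a diagonal point. -/
theorem OnDiag.le_of_adj (hk : k < m) {v : ℕ × ℕ} (hv : OnDiag n m a k v) (u w : ℕ × ℕ)
    (h : (curveGraph n m a k).Adj u w) (h1 : u.1 = v.1) (h2 : w.1 = v.1 + 1) : u.2 ≤ v.2 := by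
  obtain ⟨i, hi, hr, hd⟩ := hv
  rcases h with (⟨j, _, hu, hw, e⟩ | ⟨j, _, hw, hu, e⟩) | (⟨j, _, hu, hw, e⟩ | ⟨j, _, hw, hu, e⟩)
  · obtain rfl : j = i := by rw [← hu.div_eq hk, h1, hr.div_eq hk]
    have := hu.1
    have := hr.1
    omega
  · have := hu.1
    have := hw.1
    omega
  · obtain ⟨h3, h4⟩ := hu
    obtain ⟨h5, h6⟩ := hr
    rcases lt_trichotomy i j with hij | rfl | hij
    · obtain ⟨c, rfl⟩ := Nat.exists_eq_add_of_lt hij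
      have : (i + c + 1) * m = i * m + (c * m + m) := by ring
      omega
    · omega
    · obtain ⟨c, rfl⟩ := Nat.exists_eq_add_of_lt hij
      have : a + (j + c + 1 + 1) * m = a + (j + 1) * m + (c * m + m) := by ring
      omega
  · omega

/-! ### Lengths of paths through phases -/

/-- The signed coordinate, in the direction of the dart, of the end of a dart. -/
def dartPhase (r a : ℕ) (u v : ℕ × ℕ) : ZMod r :=
  if u.2 < v.2 then (v.2 : ZMod r) - a
  else if v.2 < u.2 then (a : ZMod r) - v.2
  else if u.1 < v.1 then (v.1 : ZMod r) else -(v.1 : ZMod r)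

theorem RowStep.dartPhase_right {r : ℕ} {u v : ℕ × ℕ} (h : RowStep n m a k u v) :
    dartPhase r a u v = (v.2 : ZMod r) - a := by
  obtain ⟨i, _, _, _, h5⟩ := h
  rw [dartPhase, if_pos (by omega)]

theorem RowStep.dartPhase_left {r : ℕ} {u v : ℕ × ℕ} (h : RowStep n m a k u v) :
    dartPhase r a v u = (a : ZMod r) - u.2 := by
  obtain ⟨i, _, _, _, h5⟩ := h
  rw [dartPhase, if_neg (by omega), if_pos (by omega)]

theorem ColStep.dartPhase_down {r : ℕ} {u v : ℕ × ℕ} (h : ColStep n m a k u v) :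
    dartPhase r a u v = (v.1 : ZMod r) := by
  obtain ⟨i, _, h3, h4, h5⟩ := h
  have := h3.1
  have := h4.1
  rw [dartPhase, if_neg (by omega), if_neg (by omega), if_pos (by omega)]

theorem ColStep.dartPhase_up {r : ℕ} {u v : ℕ × ℕ} (h : ColStep n m a k u v) :
    dartPhase r a v u = -(u.1 : ZMod r) := by
  obtain ⟨i, _, h3, h4, h5⟩ := h
  have := h3.1
  have := h4.1
  rw [dartPhase, if_neg (by omega), if_neg (by omega), if_neg (by omega)]

theorem RowStep.cast_snd {r : ℕ} {u v : ℕ × ℕ} (h : RowStep n m a k u v) :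
    (v.2 : ZMod r) = u.2 + 1 := by
  obtain ⟨i, _, _, _, h5⟩ := h
  rw [h5]
  push_cast
  rfl

theorem ColStep.cast_fst {r : ℕ} {u v : ℕ × ℕ} (h : ColStep n m a k u v) :
    (v.1 : ZMod r) = u.1 + 1 := by
  obtain ⟨i, _, _, _, h5⟩ := h
  rw [h5]
  push_cast
  rfl

/-- The phase grows by one along a path, modulo a divisor `r` of `m`, provided that `r` divides
the length `k` of the diagonal segments or these segments are avoided. -/
theorem dartPhase_step {r : ℕ} (hk : k < m) (hr : r ∣ m) (u v w : ℕ × ℕ)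
    (huv : (curveGraph n m a k).Adj u v) (hvw : (curveGraph n m a k).Adj v w) (hne : u ≠ w)
    (hd : r ∣ k ∨ ¬ OnDiag n m a k v) : dartPhase r a v w = dartPhase r a u v + 1 := by
  have hm0 : (m : ZMod r) = 0 := (ZMod.natCast_eq_zero_iff _ _).2 hr
  have turn : ∀ i j, i < n → OnRow m a k i v → OnCol m a k j v →
      (v.1 : ZMod r) = 0 ∧ (v.2 : ZMod r) = a := by
    intro i j hi h h'
    refine ⟨?_, by rw [h'.1]; push_cast; rw [hm0]; ring⟩
    -- Either a crossing or straight corner, or the lower end of a diagonal, which needs `r ∣ k`.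
    rcases h.onCol hk h' with e | ⟨rfl, e⟩
    · rw [e]; push_cast; rw [hm0]; ring
    · have hdk : r ∣ k := hd.resolve_right (not_not.2 ⟨i, hi, h, by have := h'.1; omega⟩)
      rw [e]; push_cast; rw [hm0, (ZMod.natCast_eq_zero_iff k r).2 hdk]; ring
  rcases huv with (h | h) | (h | h) <;> rcases hvw with (h' | h') | (h' | h')
  · rw [h.dartPhase_right, h'.dartPhase_right, h'.cast_snd]; ring
  · exfalso
    obtain ⟨i, _, hu, hv, e⟩ := h
    obtain ⟨j, _, hw, hv', e'⟩ := h'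
    obtain rfl := OnRow.unique hk hv hv'
    exact hne (hu.ext hw (by omega))
  · rw [h.dartPhase_right, h'.dartPhase_down, h'.cast_fst]
    obtain ⟨i, hi, hu, hv, e⟩ := h
    obtain ⟨j, _, hv', hw, e'⟩ := h'
    obtain ⟨e1, e2⟩ := turn i j hi hv hv'
    rw [e1, e2]; ring
  · have e3 := h'.cast_fst (r := r)
    rw [h.dartPhase_right, h'.dartPhase_up]
    obtain ⟨i, hi, hu, hv, e⟩ := h
    obtain ⟨j, _, hw, hv', e'⟩ := h'
    obtain ⟨e1, e2⟩ := turn i j hi hv hv'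
    rw [e1] at e3
    rw [e2]; linear_combination e3
  · exfalso
    obtain ⟨i, _, hv, hu, e⟩ := h
    obtain ⟨j, _, hv', hw, e'⟩ := h'
    obtain rfl := OnRow.unique hk hv hv'
    exact hne (hu.ext hw (by omega))
  · rw [h.dartPhase_left, h'.dartPhase_left, h'.cast_snd]; ring
  · rw [h.dartPhase_left, h'.dartPhase_down, h'.cast_fst]
    obtain ⟨i, hi, hv, hu, e⟩ := h
    obtain ⟨j, _, hv', hw, e'⟩ := h'
    obtain ⟨e1, e2⟩ := turn i j hi hv hv'
    rw [e1, e2]; ring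
  · have e3 := h'.cast_fst (r := r)
    rw [h.dartPhase_left, h'.dartPhase_up]
    obtain ⟨i, hi, hv, hu, e⟩ := h
    obtain ⟨j, _, hw, hv', e'⟩ := h'
    obtain ⟨e1, e2⟩ := turn i j hi hv hv'
    rw [e1] at e3
    rw [e2]; linear_combination e3
  · rw [h.dartPhase_down, h'.dartPhase_right, h'.cast_snd]
    obtain ⟨j, _, hu, hv', e⟩ := h
    obtain ⟨i, hi, hv, hw, e'⟩ := h'
    obtain ⟨e1, e2⟩ := turn i j hi hv hv'
    rw [e1, e2]; ring
  · have e3 := h'.cast_snd (r := r)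
    rw [h.dartPhase_down, h'.dartPhase_left]
    obtain ⟨j, _, hu, hv', e⟩ := h
    obtain ⟨i, hi, hw, hv, e'⟩ := h'
    obtain ⟨e1, e2⟩ := turn i j hi hv hv'
    rw [e2] at e3
    rw [e1]; linear_combination e3
  · rw [h.dartPhase_down, h'.dartPhase_down, h'.cast_fst]
  · exfalso
    obtain ⟨i, _, hu, hv, e⟩ := h
    obtain ⟨j, _, hw, hv', e'⟩ := h'
    exact hne (Prod.ext (by omega) (by rw [hu.1, hw.1, ← hv.1, ← hv'.1]))
  · rw [h.dartPhase_up, h'.dartPhase_right, h'.cast_snd]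
    obtain ⟨j, _, hv', hu, e⟩ := h
    obtain ⟨i, hi, hv, hw, e'⟩ := h'
    obtain ⟨e1, e2⟩ := turn i j hi hv hv'
    rw [e1, e2]; ring
  · have e3 := h'.cast_snd (r := r)
    rw [h.dartPhase_up, h'.dartPhase_left]
    obtain ⟨j, _, hv', hu, e⟩ := h
    obtain ⟨i, hi, hw, hv, e'⟩ := h'
    obtain ⟨e1, e2⟩ := turn i j hi hv hv'
    rw [e2] at e3
    rw [e1]; linear_combination e3
  · exfalso
    obtain ⟨i, _, hv, hu, e⟩ := h
    obtain ⟨j, _, hv', hw, e'⟩ := h'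
    exact hne (Prod.ext (by omega) (by rw [hu.1, hw.1, ← hv.1, ← hv'.1]))
  · have e3 := h'.cast_fst (r := r)
    rw [h.dartPhase_up, h'.dartPhase_up]; linear_combination e3

/-! ### Parametrised curves -/

/-- The `i`-th curve. -/
def curve (m a k i t : ℕ) : ℕ × ℕ :=
  (i * m + (t + k - (a + (i + 1) * m)), min t (a + (i + 1) * m))

theorem curve_adj {i : ℕ} (hi : i < n) (t : ℕ) :
    (curveGraph n m a k).Adj (curve m a k i t) (curve m a k i (t + 1)) := by
  rcases lt_or_ge t (a + (i + 1) * m) with h | h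
  · refine .inl (.inl ⟨i, hi, ?_, ?_, ?_⟩)
    · exact ⟨by simp only [curve]; omega, by simp only [curve]; omega⟩
    · exact ⟨by simp only [curve]; omega, by simp only [curve]; omega⟩
    · simp only [curve]; omega
  · refine .inr (.inl ⟨i, hi, ?_, ?_, ?_⟩)
    · exact ⟨by simp only [curve]; omega, by simp only [curve]; omega⟩
    · exact ⟨by simp only [curve]; omega, by simp only [curve]; omega⟩
    · simp only [curve]; omega

theorem curve_injective {i : ℕ} : Function.Injective (curve m a k i) := by
  intro s t h
  simp only [curve, Prod.mk.injEq] at h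
  omega

theorem curve_mem (i t : ℕ) :
    OnRow m a k i (curve m a k i t) ∨ OnCol m a k i (curve m a k i t) := by
  rcases le_total t (a + (i + 1) * m) with h | h
  · exact .inl ⟨by simp only [curve]; omega, by simp only [curve]; omega⟩
  · exact .inr ⟨by simp only [curve]; omega, by simp only [curve]; omega⟩

/-- A point lies on at most two curves. -/
theorem index_of_curve (hk : k < m) (i t : ℕ) :
    i = (curve m a k i t).1 / m ∨ i = ((curve m a k i t).2 - a) / m - 1 := by
  rcases curve_mem (m := m) (a := a) (k := k) i t with h | h
  · exact .inl (h.div_eq hk).symm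
  · exact .inr (h.div_eq hk).symm

end

/-! ### Paths between the two sides -/

section

variable {n m a b k : ℕ}

theorem OnRow.fst_lt (hk : k < m) {i : ℕ} (hi : i < n) {v : ℕ × ℕ} (h : OnRow m a k i v) :
    v.1 < n * m := by
  have h1 := h.1
  have h2 := h.2
  have : (i + 1) * m ≤ n * m := Nat.mul_le_mul_right _ hi
  have : (i + 1) * m = i * m + m := by ring
  omega

theorem OnDiag.fst_lt (hk : k < m) {v : ℕ × ℕ} (h : OnDiag n m a k v) : v.1 < n * m := by
  obtain ⟨i, hi, h, _⟩ := h
  exact h.fst_lt hk hi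

theorem rowStep_of_left (hk : k < m) {u v : ℕ × ℕ} (h : (curveGraph n m a k).Adj u v)
    (hu : u.2 = 0) : RowStep n m a k u v := by
  rcases h with (h | ⟨i, _, h1, h2, h3⟩) | (⟨i, _, h1, _⟩ | ⟨i, _, _, h1, _⟩)
  · exact h
  · omega
  all_goals
    have := h1.1
    have : (i + 1) * m = i * m + m := by ring
    omega

theorem colStep_of_bottom (hk : k < m) {u v : ℕ × ℕ} (h : (curveGraph n m a k).Adj u v)
    (hu : u.1 ≤ n * m + b) (hv : v.1 = n * m + b) : ColStep n m a k u v := by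
  rcases h with (⟨i, hi, _, h, _⟩ | ⟨i, hi, h, _, _⟩) | (h | ⟨i, _, h1, h2, h3⟩)
  · have := h.fst_lt hk hi
    omega
  · have := h.fst_lt hk hi
    omega
  · exact h
  · omega

/-- `v` lies on the left side (and `c = a`) or on the bottom side (and `c = b`). -/
def IsEnd (n m a b c : ℕ) (v : ℕ × ℕ) : Prop :=
  (v.2 = 0 ∧ c = a) ∨ (v.1 = n * m + b ∧ c = b)

/-- Reversing a dart turns phase `c` into `1 - c`; thus a path of length `l` from a `c`-end to a
`c'`-end has `c' = (1 - c) + (l - 1)`. -/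
theorem IsEnd.dartPhase {r c : ℕ} (hk : k < m) (hr : r ∣ m) {u v : ℕ × ℕ}
    (h : IsEnd n m a b c v) (huv : (curveGraph n m a k).Adj u v) (hu : u.1 ≤ n * m + b) :
    dartPhase r a u v = c ∧ dartPhase r a v u = 1 - (c : ZMod r) := by
  have hm0 : (m : ZMod r) = 0 := (ZMod.natCast_eq_zero_iff _ _).2 hr
  rcases h with ⟨h, rfl⟩ | ⟨h, rfl⟩
  · have h1 := rowStep_of_left hk huv.symm h
    rw [h1.dartPhase_right, h1.dartPhase_left, h1.cast_snd, h]
    simp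
  · have h1 := colStep_of_bottom hk huv hu h
    have h2 := h1.cast_fst (r := r)
    rw [h1.dartPhase_up, h1.dartPhase_down]
    have h3 : (v.1 : ZMod r) = c := by rw [h]; push_cast; rw [hm0]; ring
    refine ⟨h3, ?_⟩
    linear_combination h2 - h3

/-- The length modulo `r` of a path between end vertices. -/
theorem length_eq_of_isEnd {r c c' : ℕ} (hk : k < m) (hr : r ∣ m) {s e : ℕ × ℕ}
    (p : (curveGraph n m a k).Walk s e) (hp : p.IsPath) (hne : s ≠ e)
    (hs : IsEnd n m a b c s) (he : IsEnd n m a b c' e)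
    (hbox : ∀ v ∈ p.support, v.1 ≤ n * m + b)
    (hd : r ∣ k ∨ ∀ v ∈ p.support, ¬ OnDiag n m a k v) :
    (p.length : ZMod r) = c + c' := by
  cases p with
  | nil => exact absurd rfl hne
  | @cons _ u _ h p =>
    obtain ⟨z, hzS, hz, e1⟩ := SimpleGraph.Walk.IsPath.exists_last_dart (dartPhase r a)
      {v | v.1 ≤ n * m + b ∧ (r ∣ k ∨ ¬ OnDiag n m a k v)}
      (fun u v w huv hvw huw _ hv _ => dartPhase_step hk hr u v w huv hvw huw hv.2) p h hp
      (fun z hz => ⟨hbox z hz, hd.imp_right fun h => h z hz⟩)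
    rw [(he.dartPhase hk hr hz hzS.1).1,
      (hs.dartPhase hk hr h.symm (hbox u (by simp))).2] at e1
    rw [SimpleGraph.Walk.length_cons]
    push_cast
    linear_combination -e1

/-! ### The finite graph, its `A`-paths and hitting sets -/

/-- The finite set of grid points spanned by the curves. -/
def box (n m a b : ℕ) : Set (ℕ × ℕ) := {v | v.1 ≤ n * m + b ∧ v.2 ≤ a + n * m}

/-- The union of the curves as a graph on a finite vertex set. -/
def boxGraph (n m a b k : ℕ) : SimpleGraph (box n m a b) :=
  (curveGraph n m a k).induce (box n m a b)

/-- The points on the left side and on the bottom side. -/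
def boxEnds (n m a b : ℕ) : Set (box n m a b) := {v | v.1.2 = 0 ∨ v.1.1 = n * m + b}

instance : Finite (box n m a b) :=
  ((Set.finite_Iic (n * m + b)).prod (Set.finite_Iic (a + n * m))).subset fun _ h => h

/-- A path in the union of curves from the left side to the bottom side that contains a diagonal
point. -/
structure IsDiagPath (n m a b k : ℕ) {s e : ℕ × ℕ} (W : (curveGraph n m a k).Walk s e) :
    Prop where
  isPath : W.IsPath
  left : s.2 = 0
  bottom : e.1 = n * m + b
  start_lt : s.1 < e.1
  box : ∀ v ∈ W.support, v.1 ≤ n * m + b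
  eq_of_bottom : ∀ v ∈ W.support, v.1 = n * m + b → v = e
  diag : ∃ v ∈ W.support, OnDiag n m a k v

theorem IsDiagPath.exists_mem_support_of_lt (hk : k < m) {s e s' e' : ℕ × ℕ}
    {W : (curveGraph n m a k).Walk s e} {W' : (curveGraph n m a k).Walk s' e'}
    (h : IsDiagPath n m a b k W) (h' : IsDiagPath n m a b k W') (hlt : s.1 < s'.1) :
    ∃ v, v ∈ W.support ∧ v ∈ W'.support := by
  obtain ⟨t, ht, htd⟩ := h'.diag
  have hte : e' ≠ t := by
    rintro rfl
    have := htd.fst_lt hk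
    have := h'.bottom
    omega
  have hsub := W'.support_takeUntil_subset_support ht
  -- Stopping `W'` at a diagonal point removes `e'`, its only bottom vertex, so the rest stays
  -- strictly above the end of `W`.
  obtain ⟨v, hv, hv'⟩ := exists_mem_support_of_left_walks curveGraph_triStep W
    (W'.takeUntil t ht) h.left h'.left hlt (fun v hv => by
      rw [h.bottom]
      refine lt_of_le_of_ne (h'.box v (hsub hv)) fun hX => ?_
      obtain rfl := h'.eq_of_bottom v (hsub hv) hX
      exact SimpleGraph.Walk.endpoint_notMem_support_takeUntil h'.isPath ht hte hv)
    (fun u w => htd.le_of_adj hk u w)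
  exact ⟨v, hv, hsub hv'⟩

theorem IsDiagPath.exists_mem_support (hk : k < m) {s e s' e' : ℕ × ℕ}
    {W : (curveGraph n m a k).Walk s e} {W' : (curveGraph n m a k).Walk s' e'}
    (h : IsDiagPath n m a b k W) (h' : IsDiagPath n m a b k W') :
    ∃ v, v ∈ W.support ∧ v ∈ W'.support := by
  rcases lt_trichotomy s.1 s'.1 with hlt | heq | hlt
  · exact h.exists_mem_support_of_lt hk h' hlt
  · obtain rfl : s = s' := Prod.ext heq (h.left.trans h'.left.symm)
    exact ⟨s, W.start_mem_support, W'.start_mem_support⟩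
  · obtain ⟨v, hv, hv'⟩ := h'.exists_mem_support_of_lt hk h hlt
    exact ⟨v, hv', hv⟩

/-- A path from the left side to the bottom side whose length modulo `m` is not `a + b`
contains a diagonal point. -/
theorem isDiagPath_of_length (hk : k < m) {s e : ℕ × ℕ} (W : (curveGraph n m a k).Walk s e)
    (hp : W.IsPath) (hne : s ≠ e) (hs : s.2 = 0) (he : e.1 = n * m + b)
    (hbox : ∀ v ∈ W.support, v.1 ≤ n * m + b)
    (hint : ∀ v ∈ W.support, v.1 = n * m + b → v = s ∨ v = e)
    (hl : (W.length : ZMod m) ≠ a + b) : IsDiagPath n m a b k W := by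
  have hse : s.1 < e.1 := by
    cases W with
    | nil => exact absurd rfl hne
    | cons h p =>
      obtain ⟨i, hi, h, -, -⟩ := rowStep_of_left hk h hs
      have := h.fst_lt hk hi
      omega
  refine ⟨hp, hs, he, hse, hbox, fun v hv hX => ?_, ?_⟩
  · rcases hint v hv hX with rfl | h
    · omega
    · exact h
  · by_contra! hd
    exact hl (length_eq_of_isEnd hk dvd_rfl W hp hne (.inl ⟨hs, rfl⟩) (.inr ⟨he, rfl⟩) hbox
      (.inr hd))

theorem APath.exists_isDiagPath {q d : ℕ} (hk : k < m) (hqm : q ∣ m) (hqk : q ∣ k)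
    (ha : (a + a : ZMod q) ≠ d) (hb : (b + b : ZMod q) ≠ d) (hab : (d : ZMod m) ≠ a + b)
    (P : APath (boxGraph n m a b k) (boxEnds n m a b)) (hP : P.length ≡ d [MOD m]) :
    ∃ (s e : ℕ × ℕ) (W : (curveGraph n m a k).Walk s e), IsDiagPath n m a b k W ∧
      ∀ v ∈ W.support, ∃ w ∈ P.verts, w.1 = v := by
  obtain ⟨x, y, p, hp, hne, hx, hy, hint⟩ := P
  let f := (SimpleGraph.Embedding.induce (G := curveGraph n m a k) (box n m a b)).toHom
  let W : (curveGraph n m a k).Walk x.1 y.1 := p.map f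
  have hWp : W.IsPath := hp.map Subtype.val_injective
  have hsupp : ∀ v ∈ W.support, ∃ w ∈ p.support, w.1 = v := by
    intro v hv
    have hs : W.support = p.support.map f := SimpleGraph.Walk.support_map _ _
    rw [hs, List.mem_map] at hv
    exact hv
  have hbox : ∀ v ∈ W.support, v.1 ≤ n * m + b := by
    intro v hv
    obtain ⟨w, -, rfl⟩ := hsupp v hv
    exact w.2.1
  have hint' : ∀ v ∈ W.support, v.1 = n * m + b → v = x.1 ∨ v = y.1 := by
    intro v hv hX
    obtain ⟨w, hw, rfl⟩ := hsupp v hv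
    exact (hint w hw (.inr hX)).imp (congrArg _) (congrArg _)
  have hne' : x.1 ≠ y.1 := fun h => hne (Subtype.ext h)
  have hlen : W.length = p.length := SimpleGraph.Walk.length_map _ _
  have hlm : (W.length : ZMod m) = d := by
    rw [hlen]; exact (ZMod.natCast_eq_natCast_iff _ _ _).2 hP
  have hlq : (W.length : ZMod q) = d := by
    rw [hlen]; exact (ZMod.natCast_eq_natCast_iff _ _ _).2 (Nat.ModEq.of_dvd hqm hP)
  rcases hx with hx | hx <;> rcases hy with hy | hy
  · exact absurd ((length_eq_of_isEnd hk hqm W hWp hne' (.inl ⟨hx, rfl⟩) (.inl ⟨hy, rfl⟩) hbox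
      (.inl hqk)).symm.trans hlq) ha
  · exact ⟨_, _, W, isDiagPath_of_length hk W hWp hne' hx hy hbox hint' (hlm ▸ hab), hsupp⟩
  · refine ⟨_, _, W.reverse, isDiagPath_of_length hk W.reverse hWp.reverse hne'.symm hy hx
      (fun v hv => hbox v (by simpa using hv))
      (fun v hv h => (hint' v (by simpa using hv) h).symm) ?_,
      fun v hv => hsupp v (by simpa using hv)⟩
    rw [SimpleGraph.Walk.length_reverse, hlm]
    exact hab
  · exact absurd ((length_eq_of_isEnd hk hqm W hWp hne' (.inr ⟨hx, rfl⟩) (.inr ⟨hy, rfl⟩) hbox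
      (.inl hqk)).symm.trans hlq) hb

/-- Each curve is an `A`-path. -/
theorem exists_aPath_curve (hk : k < m) (hb : 0 < b) {i : ℕ} (hi : i < n) :
    ∃ P : APath (boxGraph n m a b k) (boxEnds n m a b),
      P.length + k = (n + 1) * m + a + b ∧ ∀ w ∈ P.verts, ∃ t, w.1 = curve m a k i t := by
  obtain ⟨c, rfl⟩ := Nat.exists_eq_add_of_lt hi
  set n := i + c + 1
  have hn : (n + 1) * m = i * m + (c * m + m + m) := by simp only [n]; ring
  have hn' : n * m = i * m + (c * m + m) := by simp only [n]; ring
  have hi' : (i + 1) * m = i * m + m := by ring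
  obtain ⟨l, hl⟩ : ∃ l, l + k = (n + 1) * m + a + b :=
    ⟨(n + 1) * m + a + b - k, by omega⟩
  have hbox : ∀ t ≤ l, curve m a k i t ∈ box n m a b := by
    intro t ht
    simp only [curve, box, Set.mem_ofPred_eq]
    omega
  -- Capping the index at `l` keeps all values in the box.
  let γ : ℕ → box n m a b := fun t => ⟨curve m a k i (min t l), hbox _ (min_le_right _ _)⟩
  have hγ : ∀ t ≤ l, (γ t).1 = curve m a k i t := fun t ht => by
    simp only [γ, min_eq_left ht]
  obtain ⟨W, hlen, hsupp⟩ := SimpleGraph.exists_walk_of_seq (G := boxGraph n m a b k) γ l (by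
    intro t ht
    change (curveGraph n m a k).Adj (γ t).1 (γ (t + 1)).1
    rw [hγ t ht.le, hγ (t + 1) ht]
    exact curve_adj hi t)
  have hinj : ∀ s ≤ l, ∀ t ≤ l, γ s = γ t → s = t := by
    intro s hs t ht h
    apply curve_injective (m := m) (a := a) (k := k) (i := i)
    rw [← hγ s hs, ← hγ t ht, h]
  have hmem : ∀ w ∈ W.support, ∃ t ≤ l, w = γ t := by
    intro w hw
    rw [hsupp, List.mem_map] at hw
    obtain ⟨t, ht, rfl⟩ := hw
    exact ⟨t, by simpa [Nat.lt_succ_iff] using ht, rfl⟩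
  refine ⟨⟨γ 0, γ l, W, ?_, ?_, ?_, ?_, ?_⟩, ?_, ?_⟩
  · rw [SimpleGraph.Walk.isPath_def, hsupp]
    refine List.Nodup.map_on (fun s hs t ht h => ?_) List.nodup_range
    rw [List.mem_range] at hs ht
    exact hinj s (by omega) t (by omega) h
  · intro h
    have := hinj 0 (by omega) l le_rfl h
    omega
  · left
    rw [hγ 0 (by omega)]
    simp [curve]
  · right
    rw [hγ l le_rfl]
    simp only [curve]
    omega
  · intro w hw hwA
    obtain ⟨t, ht, rfl⟩ := hmem w hw
    simp only [boxEnds, Set.mem_ofPred_eq, hγ t ht, curve] at hwA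
    rcases hwA with h | h
    · left
      congr 1
      omega
    · right
      congr 1
      omega
  · exact (congrArg (· + k) hlen).trans hl
  · intro w hw
    obtain ⟨t, ht, rfl⟩ := hmem w hw
    exact ⟨t, hγ t ht⟩

/-- Each point of `X` accounts for at most two curves, one through its row and one through its
column. -/
theorem card_hittingSet {d : ℕ} (hk : k < m) (hb : 0 < b) (hd : a + b ≡ d + k [MOD m])
    (X : Finset (box n m a b))
    (hX : IsHittingSet (boxGraph n m a b k) (boxEnds n m a b) (fun l => l ≡ d [MOD m]) X) :
    n ≤ 2 * X.card := by
  classical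
  have hsub : Finset.range n ⊆
      X.image (fun w => w.1.1 / m) ∪ X.image (fun w => (w.1.2 - a) / m - 1) := by
    intro i hi
    obtain ⟨P, hl, hP⟩ := exists_aPath_curve (n := n) (a := a) hk hb (Finset.mem_range.1 hi)
    obtain ⟨w, hw, hwP⟩ := hX P (by
      refine Nat.ModEq.add_right_cancel' k ?_
      rw [hl, add_assoc]
      refine Nat.ModEq.trans ?_ hd
      simp [Nat.ModEq])
    obtain ⟨t, ht⟩ := hP w hwP
    rw [Finset.mem_union, Finset.mem_image, Finset.mem_image]
    rcases index_of_curve (a := a) hk i t with h | h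
    · exact .inl ⟨w, hw, by rw [ht]; exact h.symm⟩
    · exact .inr ⟨w, hw, by rw [ht]; exact h.symm⟩
  calc n = (Finset.range n).card := (Finset.card_range n).symm
    _ ≤ _ := Finset.card_le_card hsub
    _ ≤ _ := Finset.card_union_le _ _
    _ ≤ X.card + X.card := add_le_add Finset.card_image_le Finset.card_image_le
    _ = 2 * X.card := by ring

end

/-! ### Choice of parameters -/

/-- A composite number greater than `4` has a proper divisor greater than `2`. -/
theorem Nat.exists_dvd_three_le {m : ℕ} (hm : 4 < m) (hcomp : ¬ m.Prime) :
    ∃ q, 3 ≤ q ∧ q < m ∧ q ∣ m := by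
  obtain ⟨q, hq, h2, hlt⟩ := Nat.exists_dvd_of_not_prime2 (by omega) hcomp
  rcases h2.lt_or_eq with h | rfl
  · exact ⟨q, h, hlt, hq⟩
  -- For the divisor 2, the cofactor exceeds 2 because `m > 4`.
  · obtain ⟨c, rfl⟩ := hq
    exact ⟨c, by omega, by omega, Dvd.intro_left 2 rfl⟩

theorem exists_graph_no_disjoint_large_hitting (m : ℕ) (hm : 4 < m) (hcomp : ¬ m.Prime)
    (d : ℕ) (N : ℕ) : ∃ (V : Type) (_ : Finite V) (G : SimpleGraph V) (A : Set V),
      ¬ HasDisjointAPaths G A (fun ℓ => ℓ ≡ d [MOD m]) 2 ∧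
      ∀ X : Finset V, IsHittingSet G A (fun ℓ => ℓ ≡ d [MOD m]) X → N < X.card := by
  obtain ⟨q, hq3, hqm, hq⟩ := Nat.exists_dvd_three_le hm hcomp
  have hq0 : (q : ZMod q) = 0 := ZMod.natCast_self q
  -- Since `q ≥ 3`, 0 and 2 differ modulo `q`, so one of `a = 0, 1` works.
  obtain ⟨a, ha1, ha⟩ : ∃ a : ℕ, a ≤ 1 ∧ (a + a : ZMod q) ≠ d := by
    by_cases h : (d : ZMod q) = 0
    · refine ⟨1, le_rfl, ?_⟩
      rw [h]
      intro h2
      have h2 : ((2 : ℕ) : ZMod q) = 0 := by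
        push_cast at h2 ⊢
        linear_combination h2
      have := Nat.le_of_dvd (by omega) ((ZMod.natCast_eq_zero_iff _ _).1 h2)
      omega
    · exact ⟨0, by omega, fun h2 => h (by rw [← h2]; simp)⟩
  obtain ⟨b, hb⟩ : ∃ b, a + b = d + q := ⟨d + q - a, by omega⟩
  have hbq : (b : ZMod q) = d - a := by
    have := congrArg (Nat.cast (R := ZMod q)) hb
    push_cast at this
    linear_combination this + hq0
  refine ⟨box (2 * N + 1) m a b, inferInstance, boxGraph _ m a b q, boxEnds _ m a b, ?_, ?_⟩
  · rintro ⟨P, hP, hdisj⟩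
    have key := fun i => (P i).exists_isDiagPath hqm hq dvd_rfl ha
      -- `b ≡ d - a` gives `2b - d ≡ d - 2a` modulo `q`.
      (fun h => ha (by rw [hbq] at h; linear_combination -h))
      (fun h => by
        have h1 : ((d : ℕ) : ZMod m) = ((d + q : ℕ) : ZMod m) := by
          rw [h, ← hb]; push_cast; rfl
        have h2 : ((q : ℕ) : ZMod m) = 0 := by
          push_cast at h1
          linear_combination -h1
        have := Nat.le_of_dvd (by omega) ((ZMod.natCast_eq_zero_iff _ _).1 h2)
        omega) (hP i)
    obtain ⟨s, e, W, hW, hWP⟩ := key 0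
    obtain ⟨s', e', W', hW', hWP'⟩ := key 1
    obtain ⟨v, hv, hv'⟩ := hW.exists_mem_support hqm hW'
    obtain ⟨w, hw, rfl⟩ := hWP v hv
    obtain ⟨w', hw', h⟩ := hWP' w.1 hv'
    obtain rfl : w' = w := Subtype.ext h
    exact Set.disjoint_left.1 (hdisj 0 1 (by decide)) hw hw'
  · intro X hX
    have := card_hittingSet hqm (by omega) (by rw [hb]) X hX
    omega

theorem proposition4p2 (m : ℕ) (hm : 4 < m) (hcomp : ¬ m.Prime) (d : ℕ) (hd : d < m) :
    ¬ APathsHaveErdosPosaProperty (fun ℓ => ℓ ≡ d [MOD m]) ∧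
    ∀ N : ℕ, ∃ (V : Type) (_ : Finite V) (G : SimpleGraph V) (A : Set V),
      ¬ HasDisjointAPaths G A (fun ℓ => ℓ ≡ d [MOD m]) 2 ∧
      ∀ X : Finset V, IsHittingSet G A (fun ℓ => ℓ ≡ d [MOD m]) X → N < X.card := by
  have key := exists_graph_no_disjoint_large_hitting m hm hcomp d
  refine ⟨?_, key⟩
  rintro ⟨f, hf⟩
  obtain ⟨V, hV, G, A, h1, h2⟩ := key (f 2)
  rcases hf 2 V G A with h | ⟨X, hX, hXh⟩
  · exact h1 h
  · exact absurd (h2 X hXh) (by omega)
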